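/- For a finite set $P$ of points in the Euclidean plane, consider the angles $\angle abc\in[0,\pi]$ formed by triples of distinct points $a,b,c\in P$. Say that $P$ is in general position if no three points of $P$ lie on a line and no four points of $P$ lie on a circle. Let $A_{\mathrm{gen}}(n)$ be the minimum, over all sets $P$ of $n$ points in general position in the plane, of the number of distinct values of the angles formed by $P$. Then, as $n\to\infty$, $$A_{\mathrm{gen}}(n) = O\!\left(n^2\, 2^{22\sqrt{\log_2 n}}\right),$$ that is, there are constants $C$ and $n_0$ such that $A_{\mathrm{gen}}(n)\le C\,n^2\,2^{22\sqrt{\log_2 n}}$ for all $n\ge n_0$. -/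

import Mathlib

open Asymptotics Filter

/-- The Euclidean plane. -/
abbrev Plane : Type := EuclideanSpace ℝ (Fin 2)

/-- A finite planar point set is in general position if no three of its points lie on a line and
no four of its points lie on a circle. (In the plane, `EuclideanGeometry.Cospherical` says that
the points lie on a common circle.) -/
def InGeneralPosition (P : Finset Plane) : Prop :=
  (∀ a ∈ P, ∀ b ∈ P, ∀ c ∈ P, a ≠ b → a ≠ c → b ≠ c →
      ¬ Collinear ℝ ({a, b, c} : Set Plane)) ∧
  (∀ a ∈ P, ∀ b ∈ P, ∀ c ∈ P, ∀ d ∈ P, a ≠ b → a ≠ c → a ≠ d → b ≠ c → b ≠ d → c ≠ d →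
      ¬ EuclideanGeometry.Cospherical ({a, b, c, d} : Set Plane))

open Classical in
/-- The set of (values of) angles `∠ a b c` formed by triples of distinct points of `P`. -/
noncomputable def angleSet (P : Finset Plane) : Finset ℝ :=
  ((P ×ˢ P ×ˢ P).filter (fun t => t.1 ≠ t.2.1 ∧ t.1 ≠ t.2.2 ∧ t.2.1 ≠ t.2.2)).image
    (fun t => EuclideanGeometry.angle t.1 t.2.1 t.2.2)

theorem mem_angleSet (P : Finset Plane) (x : ℝ) :
    x ∈ angleSet P ↔ ∃ a ∈ P, ∃ b ∈ P, ∃ c ∈ P, a ≠ b ∧ a ≠ c ∧ b ≠ c ∧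
      EuclideanGeometry.angle a b c = x := by
  simp only [angleSet, Finset.mem_image, Finset.mem_filter, Finset.mem_product, Prod.exists]
  constructor
  · rintro ⟨a, b, c, ⟨⟨ha, hb, hc⟩, h1, h2, h3⟩, h⟩
    exact ⟨a, ha, b, hb, c, hc, h1, h2, h3, h⟩
  · rintro ⟨a, ha, b, hb, c, hc, h1, h2, h3, h⟩
    exact ⟨a, b, c, ⟨⟨ha, hb, hc⟩, h1, h2, h3⟩, h⟩

/-- The numbers of distinct angles formed by the sets of `n` points in general position. -/
def angleCounts (n : ℕ) : Set ℕ :=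
  {k | ∃ P : Finset Plane, P.card = n ∧ InGeneralPosition P ∧ (angleSet P).card = k}

/-- The minimum number of distinct angles formed by `n` points in general position in the plane.
The minimum is over a nonempty set, see `Agen_isLeast`. -/
noncomputable def Agen (n : ℕ) : ℕ := sInf (angleCounts n)

/-- There are `n` points in general position for every `n` (on half a parabola). -/
theorem angleCounts_nonempty (n : ℕ) : (angleCounts n).Nonempty := by
  classical
  let f : ℕ → Plane := fun k => !₂[(k : ℝ) + 1, ((k : ℝ) + 1) ^ 2]
  have hf0 : ∀ k, f k 0 = (k : ℝ) + 1 := fun k => by simp [f]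
  have hf1 : ∀ k, f k 1 = ((k : ℝ) + 1) ^ 2 := fun k => by simp [f]
  have hinj : Function.Injective f := by
    intro i j h
    have h0 : f i 0 = f j 0 := by rw [h]
    rw [hf0, hf0] at h0
    have h1 : (i : ℝ) = j := add_right_cancel h0
    exact_mod_cast h1
  refine ⟨_, (Finset.range n).image f, ?_, ⟨?_, ?_⟩, rfl⟩
  · rw [Finset.card_image_of_injective _ hinj, Finset.card_range]
  · simp only [Finset.mem_image]
    rintro _ ⟨i, -, rfl⟩ _ ⟨j, -, rfl⟩ _ ⟨k, -, rfl⟩ hij hik hjk hcol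
    have ne : ∀ {p q : ℕ}, f p ≠ f q → (p : ℝ) - q ≠ 0 := by
      intro p q h h'
      exact h (congrArg f (by exact_mod_cast sub_eq_zero.mp h'))
    obtain ⟨p, v, hv⟩ := (collinear_iff_exists_forall_eq_smul_vadd _).1 hcol
    obtain ⟨r, hr⟩ := hv (f i) (by simp)
    obtain ⟨s, hs⟩ := hv (f j) (by simp)
    obtain ⟨t, ht⟩ := hv (f k) (by simp)
    have r0 := hf0 i
    have r1 := hf1 i
    have s0 := hf0 j
    have s1 := hf1 j
    have t0 := hf0 k
    have t1 := hf1 k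
    rw [hr] at r0 r1
    rw [hs] at s0 s1
    rw [ht] at t0 t1
    simp only [vadd_eq_add, PiLp.add_apply, PiLp.smul_apply, smul_eq_mul] at r0 r1 s0 s1 t0 t1
    have key : ((i : ℝ) - j) * ((i : ℝ) - k) * ((j : ℝ) - k) = 0 := by
      have e1 : (i : ℝ) - j = (r - s) * v 0 := by linear_combination s0 - r0
      have e2 : (i : ℝ) - k = (r - t) * v 0 := by linear_combination t0 - r0
      have e3 : ((i : ℝ) - j) * (i + j + 2) = (r - s) * v 1 := by linear_combination s1 - r1
      have e4 : ((i : ℝ) - k) * (i + k + 2) = (r - t) * v 1 := by linear_combination t1 - r1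
      linear_combination (i - k : ℝ) * e3 - (i - j : ℝ) * e4 + (r - s) * v 1 * e2
        - (r - t) * v 1 * e1
    exact mul_ne_zero (mul_ne_zero (ne hij) (ne hik)) (ne hjk) key
  · simp only [Finset.mem_image]
    rintro _ ⟨i, -, rfl⟩ _ ⟨j, -, rfl⟩ _ ⟨k, -, rfl⟩ _ ⟨l, -, rfl⟩ hij hik hil hjk hjl hkl
      ⟨c, ρ, hc⟩
    have ne : ∀ {p q : ℕ}, f p ≠ f q → ((p : ℝ) + 1) - (q + 1) ≠ 0 := by
      intro p q h h'
      rw [add_sub_add_right_eq_sub] at h'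
      exact h (congrArg f (by exact_mod_cast sub_eq_zero.mp h'))
    have hd : ∀ m, dist (f m) c = ρ →
        ((m : ℝ) + 1 - c 0) ^ 2 + (((m : ℝ) + 1) ^ 2 - c 1) ^ 2 = ρ ^ 2 := by
      intro m hm
      rw [← hm, EuclideanSpace.dist_eq, Real.sq_sqrt (by positivity)]
      simp [Fin.sum_univ_two, Real.dist_eq, sq_abs, hf0, hf1]
    have ei := hd i (hc _ (by simp))
    have ej := hd j (hc _ (by simp))
    have ek := hd k (hc _ (by simp))
    have el := hd l (hc _ (by simp))
    have xi : (0 : ℝ) < (i : ℝ) + 1 := by positivity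
    have xj : (0 : ℝ) < (j : ℝ) + 1 := by positivity
    have xk : (0 : ℝ) < (k : ℝ) + 1 := by positivity
    have xl : (0 : ℝ) < (l : ℝ) + 1 := by positivity
    have nij := ne hij
    have nik := ne hik
    have nil' := ne hil
    have njk := ne hjk
    have njl := ne hjl
    have nkl := ne hkl
    generalize (i : ℝ) + 1 = w at *
    generalize (j : ℝ) + 1 = x at *
    generalize (k : ℝ) + 1 = y at *
    generalize (l : ℝ) + 1 = z at *
    generalize c 0 = A at *
    generalize c 1 = B at *
    have d1 : ∀ u : ℝ, w - u ≠ 0 → (u - A) ^ 2 + (u ^ 2 - B) ^ 2 = ρ ^ 2 →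
        w ^ 3 + w ^ 2 * u + w * u ^ 2 + u ^ 3 + (1 - 2 * B) * (w + u) - 2 * A = 0 := by
      intro u hu h
      apply mul_left_cancel₀ hu
      linear_combination ei - h
    have gx := d1 x nij ej
    have gy := d1 y nik ek
    have gz := d1 z nil' el
    have d2 : ∀ u : ℝ, x - u ≠ 0 →
        w ^ 3 + w ^ 2 * u + w * u ^ 2 + u ^ 3 + (1 - 2 * B) * (w + u) - 2 * A = 0 →
        w ^ 2 + w * (x + u) + x ^ 2 + x * u + u ^ 2 + (1 - 2 * B) = 0 := by
      intro u hu h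
      apply mul_left_cancel₀ hu
      linear_combination gx - h
    have ky := d2 y njk gy
    have kz := d2 z njl gz
    have : w + x + y + z = 0 := by
      apply mul_left_cancel₀ nkl
      linear_combination ky - kz
    linarith

/-- `Agen n` is attained, and is the least number of distinct angles. -/
theorem Agen_isLeast (n : ℕ) : IsLeast (angleCounts n) (Agen n) :=
  ⟨Nat.sInf_mem (angleCounts_nonempty n), fun _ hk => Nat.sInf_le hk⟩

/-! An angle at `b` depends only on the two difference vectors leaving `b`, so a set with few
differences has few angles: at most the square of their number. A box in `ℤ^d` has few differences,
and so has its lift to the paraboloid, because the extra coordinate takes only polynomially many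
values. The lift has no three collinear points. A linear map to the plane creates no new
differences, and a generic one puts the lifted box in general position: each line or circle
determinant is a polynomial in the map, not identically zero, so all of them can be made nonzero at
once (`exists_generic_pair`). With side `2 ^ d` and `d` about `√(log₂ n)`, the box has at least `n`
points and `n * 2 ^ O(d)` differences. -/

/-! ### Generic pairs of linear functionals -/

open Matrix in
theorem exists_dotProduct_eq_zero_and_ne {ι : Type*} [Fintype ι] {u v : ι → ℝ} (hu : u ≠ 0)
    (hv : ∀ c : ℝ, v ≠ c • u) : ∃ f : ι → ℝ, f ⬝ᵥ u = 0 ∧ f ⬝ᵥ v ≠ 0 := by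
  have huu : u ⬝ᵥ u ≠ 0 := fun h => hu (dotProduct_self_eq_zero.1 h)
  -- The component of `v` orthogonal to `u`, scaled to avoid division.
  set f : ι → ℝ := (u ⬝ᵥ u) • v - (u ⬝ᵥ v) • u with hf
  have hfu : f ⬝ᵥ u = 0 := by
    rw [hf, sub_dotProduct, smul_dotProduct, smul_dotProduct, dotProduct_comm v u]
    simp only [smul_eq_mul]
    ring
  refine ⟨f, hfu, fun hfv => ?_⟩
  have hff : f ⬝ᵥ f = 0 := by
    conv_lhs => rw [hf]
    rw [← hf, sub_dotProduct, smul_dotProduct, smul_dotProduct, dotProduct_comm v f,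
      dotProduct_comm u f, hfu, hfv]
    simp
  have hf0 : f = 0 := dotProduct_self_eq_zero.1 hff
  apply hv ((u ⬝ᵥ u)⁻¹ * (u ⬝ᵥ v))
  rw [mul_smul, ← sub_eq_zero.1 (hf.symm.trans hf0), smul_smul, inv_mul_cancel₀ huu, one_smul]

open Matrix in
/-- Two nonvanishing conditions on a vector, each satisfiable within a set closed under addition,
are satisfiable together. -/
theorem exists_dotProduct_ne_and_ne {ι : Type*} [Fintype ι] {S : AddSubmonoid (ι → ℝ)}
    {v w : ι → ℝ} (hv : ∃ f ∈ S, f ⬝ᵥ v ≠ 0) (hw : ∃ f ∈ S, f ⬝ᵥ w ≠ 0) :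
    ∃ f ∈ S, f ⬝ᵥ v ≠ 0 ∧ f ⬝ᵥ w ≠ 0 := by
  obtain ⟨f, hfS, hf⟩ := hv
  obtain ⟨g, hgS, hg⟩ := hw
  by_cases h1 : f ⬝ᵥ w = 0
  · by_cases h2 : g ⬝ᵥ v = 0
    · exact ⟨f + g, S.add_mem hfS hgS, by rwa [add_dotProduct, h2, add_zero],
        by rwa [add_dotProduct, h1, zero_add]⟩
    · exact ⟨g, hgS, h2, hg⟩
  · exact ⟨f, hfS, hf, h1⟩

/-- The determinant with rows `(fᵢ, gᵢ, fᵢ ^ 2 + gᵢ ^ 2)`. It vanishes if the points `(fᵢ, gᵢ)` lie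
on a circle through the origin. -/
def circleDet {R : Type*} [CommRing R] (f₁ g₁ f₂ g₂ f₃ g₃ : R) : R :=
  f₁ * (g₂ * (f₃ ^ 2 + g₃ ^ 2) - g₃ * (f₂ ^ 2 + g₂ ^ 2))
    - g₁ * (f₂ * (f₃ ^ 2 + g₃ ^ 2) - f₃ * (f₂ ^ 2 + g₂ ^ 2))
    + (f₁ ^ 2 + g₁ ^ 2) * (f₂ * g₃ - f₃ * g₂)

theorem map_circleDet {R S : Type*} [CommRing R] [CommRing S] (φ : R →+* S)
    (f₁ g₁ f₂ g₂ f₃ g₃ : R) : φ (circleDet f₁ g₁ f₂ g₂ f₃ g₃) =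
      circleDet (φ f₁) (φ g₁) (φ f₂) (φ g₂) (φ f₃) (φ g₃) := by
  simp [circleDet]

/-- The determinant has only terms in `s` and `s ^ 3`, and the cubic coefficient forces `f₂ = f₃` if
it always vanishes. Then the four points form two parallel chords, concyclic only if their midpoints
are level, and the shear `t` destroys this. -/
theorem exists_circleDet_ne_zero {g₁ f₂ g₂ f₃ g₃ : ℝ} (hg₁ : g₁ ≠ 0) (hf₂ : f₂ ≠ 0)
    (hf₃ : f₃ ≠ 0) (hg : g₂ - g₃ ≠ 0) : ∃ s t : ℝ,
      circleDet (s * 0) (g₁ + t * 0) (s * f₂) (g₂ + t * f₂) (s * f₃) (g₃ + t * f₃) ≠ 0 := by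
  by_contra! h
  have h1 := h 1 0
  have h2 := h 2 0
  have h3 := h 1 1
  simp only [circleDet] at h1 h2 h3
  -- The combination `h2 - 2 * h1` cancels the linear term; it is `2 ^ 3 - 2 = 6` times the cubic
  -- coefficient.
  have h4 : f₂ - f₃ = 0 := by
    have : g₁ * f₂ * f₃ * (f₂ - f₃) = 0 := by linear_combination (h2 - 2 * h1) / 6
    simpa [hg₁, hf₂, hf₃] using this
  obtain rfl : f₂ = f₃ := sub_eq_zero.1 h4
  have : g₁ * f₂ ^ 2 * (g₂ - g₃) = 0 := by linear_combination (h3 - h1) / 2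
  simp [hg₁, hf₂, hg] at this

open Matrix in
theorem exists_dotProduct_circleDet_ne_zero {ι : Type*} [Fintype ι] {u v w : ι → ℝ} (hu : u ≠ 0)
    (hv : ∀ c : ℝ, v ≠ c • u) (hw : ∀ c : ℝ, w ≠ c • u) (hvw : v ≠ w) : ∃ f g : ι → ℝ,
      circleDet (f ⬝ᵥ u) (g ⬝ᵥ u) (f ⬝ᵥ v) (g ⬝ᵥ v) (f ⬝ᵥ w) (g ⬝ᵥ w) ≠ 0 := by
  let S : AddSubmonoid (ι → ℝ) :=
    { carrier := {f | f ⬝ᵥ u = 0}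
      zero_mem' := zero_dotProduct u
      add_mem' := fun {a b} ha hb => by
        simp only [Set.mem_ofPred_eq] at ha hb ⊢
        rw [add_dotProduct, ha, hb, add_zero] }
  obtain ⟨f, hf, hfv, hfw⟩ := exists_dotProduct_ne_and_ne (S := S)
    (exists_dotProduct_eq_zero_and_ne hu hv) (exists_dotProduct_eq_zero_and_ne hu hw)
  obtain ⟨g, -, hgu, hg⟩ := exists_dotProduct_ne_and_ne (S := ⊤) (v := u) (w := v - w)
    ⟨u, trivial, fun h => hu (dotProduct_self_eq_zero.1 h)⟩
    ⟨v - w, trivial, fun h => hvw (sub_eq_zero.1 (dotProduct_self_eq_zero.1 h))⟩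
  rw [dotProduct_sub] at hg
  obtain ⟨s, t, h⟩ := exists_circleDet_ne_zero hgu hfv hfw hg
  refine ⟨s • f, g + t • f, ?_⟩
  have hf : f ⬝ᵥ u = 0 := hf
  simpa only [add_dotProduct, smul_dotProduct, smul_eq_mul, hf] using h

open Matrix in
theorem exists_dotProduct_det_ne_zero {ι : Type*} [Fintype ι] {u v : ι → ℝ} (hu : u ≠ 0)
    (hv : ∀ c : ℝ, v ≠ c • u) : ∃ f g : ι → ℝ,
      (f ⬝ᵥ u) * (g ⬝ᵥ v) - (f ⬝ᵥ v) * (g ⬝ᵥ u) ≠ 0 := by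
  obtain ⟨f, hfu, hfv⟩ := exists_dotProduct_eq_zero_and_ne hu hv
  refine ⟨f, u, ?_⟩
  rw [hfu, zero_mul, zero_sub, neg_ne_zero]
  exact mul_ne_zero hfv fun h => hu (dotProduct_self_eq_zero.1 h)

theorem MvPolynomial.exists_forall_eval_ne_zero {σ R α : Type*} [CommRing R] [IsDomain R]
    [Infinite R] (s : Finset α) (p : α → MvPolynomial σ R) (hp : ∀ a ∈ s, p a ≠ 0) :
    ∃ x : σ → R, ∀ a ∈ s, eval x (p a) ≠ 0 := by
  have h : ∏ a ∈ s, p a ≠ 0 := Finset.prod_ne_zero_iff.2 hp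
  obtain ⟨x, hx⟩ : ∃ x : σ → R, eval x (∏ a ∈ s, p a) ≠ 0 := by
    by_contra! h'
    exact h (MvPolynomial.funext fun x => by rw [h' x, map_zero])
  refine ⟨x, ?_⟩
  rw [map_prod] at hx
  exact Finset.prod_ne_zero_iff.1 hx

/-- The dot product of `u` with the vector of variables indexed by `inj`. -/
noncomputable def dotVars {ι σ : Type*} [Fintype ι] (inj : ι → σ) (u : ι → ℝ) :
    MvPolynomial σ ℝ :=
  ∑ i, MvPolynomial.X (inj i) * MvPolynomial.C (u i)

open Matrix in
theorem eval_dotVars {ι σ : Type*} [Fintype ι] (inj : ι → σ) (u : ι → ℝ) (x : σ → ℝ) :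
    MvPolynomial.eval x (dotVars inj u) = (x ∘ inj) ⬝ᵥ u := by
  simp [dotVars, dotProduct]

open Matrix Classical in
/-- A generic pair of vectors satisfies all satisfiable conditions of nonvanishing of the
determinants of lines and circles. -/
theorem exists_generic_pair {ι : Type*} [Fintype ι] (T : Finset (ι → ℝ)) : ∃ f g : ι → ℝ,
    (∀ u ∈ T, ∀ v ∈ T, u ≠ 0 → (∀ c : ℝ, v ≠ c • u) →
      (f ⬝ᵥ u) * (g ⬝ᵥ v) - (f ⬝ᵥ v) * (g ⬝ᵥ u) ≠ 0) ∧
    (∀ u ∈ T, ∀ v ∈ T, ∀ w ∈ T, u ≠ 0 → (∀ c : ℝ, v ≠ c • u) → (∀ c : ℝ, w ≠ c • u) → v ≠ w →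
      circleDet (f ⬝ᵥ u) (g ⬝ᵥ u) (f ⬝ᵥ v) (g ⬝ᵥ v) (f ⬝ᵥ w) (g ⬝ᵥ w) ≠ 0) ∧
    (∀ u ∈ T, u ≠ 0 → f ⬝ᵥ u ≠ 0) := by
  let F : (ι → ℝ) → MvPolynomial (ι ⊕ ι) ℝ := dotVars Sum.inl
  let G : (ι → ℝ) → MvPolynomial (ι ⊕ ι) ℝ := dotVars Sum.inr
  have hF : ∀ (f g u : ι → ℝ), MvPolynomial.eval (Sum.elim f g) (F u) = f ⬝ᵥ u := fun f g u =>
    eval_dotVars _ _ _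
  have hG : ∀ (f g u : ι → ℝ), MvPolynomial.eval (Sum.elim f g) (G u) = g ⬝ᵥ u := fun f g u =>
    eval_dotVars _ _ _
  let L : (ι → ℝ) × (ι → ℝ) → MvPolynomial (ι ⊕ ι) ℝ := fun t =>
    F t.1 * G t.2 - F t.2 * G t.1
  let D : (ι → ℝ) × (ι → ℝ) × (ι → ℝ) → MvPolynomial (ι ⊕ ι) ℝ := fun t =>
    circleDet (F t.1) (G t.1) (F t.2.1) (G t.2.1) (F t.2.2) (G t.2.2)
  have hL : ∀ f g u v, MvPolynomial.eval (Sum.elim f g) (L (u, v)) =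
      (f ⬝ᵥ u) * (g ⬝ᵥ v) - (f ⬝ᵥ v) * (g ⬝ᵥ u) := fun f g u v => by
    simp only [L, map_sub, map_mul, hF, hG]
  have hD : ∀ f g u v w, MvPolynomial.eval (Sum.elim f g) (D (u, v, w)) =
      circleDet (f ⬝ᵥ u) (g ⬝ᵥ u) (f ⬝ᵥ v) (g ⬝ᵥ v) (f ⬝ᵥ w) (g ⬝ᵥ w) := fun f g u v w => by
    simp only [D, map_circleDet, hF, hG]
  -- Identically zero determinants, from degenerate tuples, are discarded; `key` shows that a
  -- polynomial with one nonzero value survives the filter.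
  obtain ⟨x, hx⟩ := MvPolynomial.exists_forall_eval_ne_zero
    (((T ×ˢ T).image L ∪ (T ×ˢ T ×ˢ T).image D ∪ T.image F).filter (· ≠ 0)) id
    fun p hp => (Finset.mem_filter.1 hp).2
  rw [← Sum.elim_comp_inl_inr x] at hx
  have key : ∀ p, (∃ y, MvPolynomial.eval y p ≠ 0) →
      p ∈ (T ×ˢ T).image L ∪ (T ×ˢ T ×ˢ T).image D ∪ T.image F →
      MvPolynomial.eval (Sum.elim (x ∘ Sum.inl) (x ∘ Sum.inr)) p ≠ 0 := by
    rintro p ⟨y, hy⟩ hp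
    refine hx p (Finset.mem_filter.2 ⟨hp, ?_⟩)
    rintro rfl
    exact hy (map_zero _)
  refine ⟨x ∘ Sum.inl, x ∘ Sum.inr, fun u hu v hv h0 h1 => ?_,
    fun u hu v hv w hw h0 h1 h2 h3 => ?_, fun u hu h0 => ?_⟩
  · obtain ⟨f, g, h⟩ := exists_dotProduct_det_ne_zero h0 h1
    rw [← hL] at h ⊢
    exact key _ ⟨_, h⟩ (Finset.mem_union_left _ (Finset.mem_union_left _
      (Finset.mem_image_of_mem _ (Finset.mk_mem_product hu hv))))
  · obtain ⟨f, g, h⟩ := exists_dotProduct_circleDet_ne_zero h0 h1 h2 h3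
    rw [← hD] at h ⊢
    exact key _ ⟨_, h⟩ (Finset.mem_union_left _ (Finset.mem_union_right _
      (Finset.mem_image_of_mem _ (Finset.mk_mem_product hu (Finset.mk_mem_product hv hw)))))
  · have h : u ⬝ᵥ u ≠ 0 := fun h => h0 (dotProduct_self_eq_zero.1 h)
    rw [← hF u u] at h
    rw [← hF (x ∘ Sum.inl) (x ∘ Sum.inr)]
    exact key _ ⟨_, h⟩ (Finset.mem_union_right _ (Finset.mem_image_of_mem _ hu))

/-! ### Lines and circles as vanishing determinants -/

theorem Collinear.plane_det_eq_zero {a b c : Plane} (h : Collinear ℝ ({a, b, c} : Set Plane)) :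
    (b 0 - a 0) * (c 1 - a 1) - (c 0 - a 0) * (b 1 - a 1) = 0 := by
  obtain ⟨v, hv⟩ := (collinear_iff_of_mem (p₀ := a) (by simp)).1 h
  obtain ⟨s, hs⟩ := hv b (by simp)
  obtain ⟨t, ht⟩ := hv c (by simp)
  rw [hs, ht]
  simp only [vadd_eq_add, PiLp.add_apply, PiLp.smul_apply, smul_eq_mul]
  ring

/-- On a circle through `a`, the squared distance to `a` is a linear function of `p - a`, so the
third column of the determinant depends on the first two. -/
theorem EuclideanGeometry.Cospherical.circleDet_eq_zero {a b c d : Plane}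
    (h : EuclideanGeometry.Cospherical ({a, b, c, d} : Set Plane)) :
    circleDet (b 0 - a 0) (b 1 - a 1) (c 0 - a 0) (c 1 - a 1) (d 0 - a 0) (d 1 - a 1) = 0 := by
  obtain ⟨o, r, ho⟩ := h
  have hr : ∀ p ∈ ({a, b, c, d} : Set Plane), (p 0 - o 0) ^ 2 + (p 1 - o 1) ^ 2 = r ^ 2 := by
    intro p hp
    rw [← ho p hp, EuclideanSpace.dist_eq, Real.sq_sqrt (by positivity)]
    simp [Fin.sum_univ_two, Real.dist_eq, sq_abs]
  have ha := hr a (by simp)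
  have hq : ∀ p ∈ ({a, b, c, d} : Set Plane), (p 0 - a 0) ^ 2 + (p 1 - a 1) ^ 2 =
      2 * (o 0 - a 0) * (p 0 - a 0) + 2 * (o 1 - a 1) * (p 1 - a 1) := by
    intro p hp
    linear_combination hr p hp - ha
  rw [circleDet, hq b (by simp), hq c (by simp), hq d (by simp)]
  ring

/-! ### The lifted box and its projection -/

/-- The lift of `x` to the paraboloid. -/
def liftParaboloid {d : ℕ} (x : Fin d → ℤ) : Option (Fin d) → ℤ
  | none => ∑ i, x i ^ 2
  | some i => x i

theorem liftParaboloid_injective {d : ℕ} :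
    Function.Injective (liftParaboloid : (Fin d → ℤ) → Option (Fin d) → ℤ) :=
  fun _ _ h => funext fun i => congrFun h (some i)

/-- A line meets the paraboloid at most twice: along `x + c (y - x)` the quadratic coordinate agrees
with the linear one only if `c ^ 2 = c`, that is, at `x` or `y`. -/
theorem liftParaboloid_sub_ne_smul {d : ℕ} {x y z : Fin d → ℤ} (hxy : x ≠ y) (hxz : x ≠ z)
    (hyz : y ≠ z) (c : ℝ) :
    (fun i => ((liftParaboloid z i - liftParaboloid x i : ℤ) : ℝ)) ≠
      c • fun i => ((liftParaboloid y i - liftParaboloid x i : ℤ) : ℝ) := by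
  intro h
  have h0 : ∑ i, (z i : ℝ) ^ 2 - ∑ i, (x i : ℝ) ^ 2 =
      c * (∑ i, (y i : ℝ) ^ 2 - ∑ i, (x i : ℝ) ^ 2) := by
    simpa [liftParaboloid] using congrFun h none
  have h1 : ∀ i, (z i : ℝ) - x i = c * (y i - x i) := fun i => by
    simpa [liftParaboloid] using congrFun h (some i)
  have h2 : (c ^ 2 - c) * ∑ i, ((y i : ℝ) - x i) ^ 2 = 0 := by
    rw [← Finset.sum_sub_distrib, ← Finset.sum_sub_distrib, Finset.mul_sum] at h0
    rw [Finset.mul_sum, ← sub_eq_zero.2 h0, ← Finset.sum_sub_distrib]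
    refine Finset.sum_congr rfl fun i _ => ?_
    have hz : (z i : ℝ) = x i + c * (y i - x i) := by linear_combination h1 i
    rw [hz]
    ring
  rcases mul_eq_zero.1 h2 with h3 | h3
  · have h4 : c * (c - 1) = 0 := by linear_combination h3
    rcases mul_eq_zero.1 h4 with h5 | h5
    · refine hxz (funext fun i => ?_)
      have := h1 i
      rw [h5, zero_mul, sub_eq_zero] at this
      exact_mod_cast this.symm
    · refine hyz (funext fun i => ?_)
      have := h1 i
      rw [sub_eq_zero.1 h5, one_mul] at this
      exact_mod_cast (sub_left_injective this).symm
  · refine hxy (funext fun i => ?_)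
    have h4 := (Finset.sum_eq_zero_iff_of_nonneg fun i _ => sq_nonneg _).1 h3 i (Finset.mem_univ i)
    exact_mod_cast (sub_eq_zero.1 (pow_eq_zero_iff two_ne_zero |>.1 h4)).symm

open Classical in
theorem card_angleSet_le_of_sub_mem (P : Finset Plane) (T : Finset Plane)
    (hT : ∀ a ∈ P, ∀ b ∈ P, a - b ∈ T) : (angleSet P).card ≤ T.card ^ 2 := by
  rw [sq, ← Finset.card_product]
  refine le_trans (Finset.card_le_card (t := (T ×ˢ T).image fun t =>
    InnerProductGeometry.angle t.1 t.2) fun θ hθ => ?_) Finset.card_image_le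
  obtain ⟨a, ha, b, hb, c, hc, -, -, -, rfl⟩ := (mem_angleSet P θ).1 hθ
  exact Finset.mem_image.2 ⟨(a - b, c - b), Finset.mk_mem_product (hT a ha b hb) (hT c hc b hb),
    rfl⟩

theorem InGeneralPosition.subset {P Q : Finset Plane} (hQ : InGeneralPosition Q) (h : P ⊆ Q) :
    InGeneralPosition P :=
  ⟨fun a ha b hb c hc => hQ.1 a (h ha) b (h hb) c (h hc),
    fun a ha b hb c hc d hd => hQ.2 a (h ha) b (h hb) c (h hc) d (h hd)⟩

open Classical in
theorem Agen_le_of_sub_mem {n : ℕ} {Q T : Finset Plane} (hQ : InGeneralPosition Q)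
    (hn : n ≤ Q.card) (hT : ∀ a ∈ Q, ∀ b ∈ Q, a - b ∈ T) : Agen n ≤ T.card ^ 2 := by
  obtain ⟨P, hPQ, hP⟩ := Finset.exists_subset_card_eq hn
  exact ((Agen_isLeast n).2 ⟨P, hP, hQ.subset hPQ, rfl⟩).trans
    (card_angleSet_le_of_sub_mem P T fun a ha b hb => hT a (hPQ ha) b (hPQ hb))

open Matrix Classical in
theorem Agen_le_of_le_pow {n k d : ℕ} (hn : n ≤ k ^ d) :
    Agen n ≤ ((2 * k + 1) ^ d * (2 * (d * k ^ 2) + 1)) ^ 2 := by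
  let B : Finset (Fin d → ℤ) := Fintype.piFinset fun _ => Finset.Ico 0 (k : ℤ)
  have hB : B.card = k ^ d := by simp [B]
  -- A box holding all differences of lifted points; a sum of `d` squares below `k ^ 2` varies by at
  -- most `d * k ^ 2`.
  let W : Finset (Option (Fin d) → ℤ) := Fintype.piFinset fun o =>
    o.elim (Finset.Icc (-(d * k ^ 2 : ℤ)) (d * k ^ 2)) fun _ => Finset.Icc (-(k : ℤ)) k
  have hW : W.card = (2 * k + 1) ^ d * (2 * (d * k ^ 2) + 1) := by
    simp only [W, Fintype.card_piFinset, Fintype.prod_option, Option.elim, Int.card_Icc,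
      Finset.prod_const, Finset.card_univ, Fintype.card_fin]
    rw [mul_comm]
    congr 1
    · congr 1
      omega
    · have : ((d * k ^ 2 : ℕ) : ℤ) = d * k ^ 2 := by push_cast; rfl
      rw [← this]
      omega
  have hBW : ∀ x ∈ B, ∀ y ∈ B, liftParaboloid x - liftParaboloid y ∈ W := by
    intro x hx y hy
    have hx' : ∀ i, 0 ≤ x i ∧ x i < k := fun i => Finset.mem_Ico.1 (Fintype.mem_piFinset.1 hx i)
    have hy' : ∀ i, 0 ≤ y i ∧ y i < k := fun i => Finset.mem_Ico.1 (Fintype.mem_piFinset.1 hy i)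
    have hs : ∀ z : Fin d → ℤ, (∀ i, 0 ≤ z i ∧ z i < k) →
        0 ≤ ∑ i, z i ^ 2 ∧ ∑ i, z i ^ 2 ≤ d * k ^ 2 := fun z hz => by
      refine ⟨Finset.sum_nonneg fun i _ => sq_nonneg _, ?_⟩
      refine (Finset.sum_le_card_nsmul _ _ ((k : ℤ) ^ 2) fun i _ =>
        pow_le_pow_left₀ (hz i).1 (hz i).2.le 2).trans ?_
      simp
    refine Fintype.mem_piFinset.2 fun o => ?_
    cases o with
    | none =>
      have h1 := hs x hx'
      have h2 := hs y hy'
      simp only [Option.elim, Pi.sub_apply, liftParaboloid, Finset.mem_Icc]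
      constructor <;> linarith
    | some i =>
      have h1 := hx' i
      have h2 := hy' i
      simp only [Option.elim, Pi.sub_apply, liftParaboloid, Finset.mem_Icc]
      constructor <;> linarith
  let toReal : (Option (Fin d) → ℤ) → Option (Fin d) → ℝ := fun w i => (w i : ℝ)
  obtain ⟨f, g, hline, hcirc, hinj⟩ := exists_generic_pair (W.image toReal)
  let φ : (Option (Fin d) → ℤ) → Plane := fun w => !₂[f ⬝ᵥ toReal w, g ⬝ᵥ toReal w]
  have hφ0 : ∀ w, φ w 0 = f ⬝ᵥ toReal w := fun w => rfl
  have hφ1 : ∀ w, φ w 1 = g ⬝ᵥ toReal w := fun w => rfl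
  have toReal_sub : ∀ v w, toReal (v - w) = toReal v - toReal w := fun v w => by
    ext i
    simp [toReal]
  have hφsub : ∀ v w, φ (v - w) = φ v - φ w := fun v w => by
    ext i
    fin_cases i
    · simp [φ, toReal_sub, dotProduct_sub]
    · simp [φ, toReal_sub, dotProduct_sub]
  have hφs0 : ∀ v w, φ v 0 - φ w 0 = f ⬝ᵥ toReal (v - w) := fun v w => by
    rw [← hφ0, hφsub, PiLp.sub_apply]
  have hφs1 : ∀ v w, φ v 1 - φ w 1 = g ⬝ᵥ toReal (v - w) := fun v w => by
    rw [← hφ1, hφsub, PiLp.sub_apply]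
  have hmem : ∀ x ∈ B, ∀ y ∈ B, toReal (liftParaboloid x - liftParaboloid y) ∈ W.image toReal :=
    fun x hx y hy => Finset.mem_image_of_mem _ (hBW x hx y hy)
  have hne : ∀ x y : Fin d → ℤ, x ≠ y → toReal (liftParaboloid x - liftParaboloid y) ≠ 0 := by
    intro x y hxy h
    refine hxy (liftParaboloid_injective (funext fun i => ?_))
    have := congrFun h i
    simp only [toReal, Pi.sub_apply, Pi.zero_apply, Int.cast_eq_zero, sub_eq_zero] at this
    exact this
  have hcard : ((B.image fun x => φ (liftParaboloid x))).card = k ^ d := by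
    rw [Finset.card_image_of_injOn, hB]
    intro x hx y hy hxy
    by_contra h
    -- The functional `f` alone already separates the lifted points.
    apply hinj _ (hmem x hx y hy) (hne x y h)
    rw [← hφs0]
    exact sub_eq_zero.2 (congrArg (fun p : Plane => p 0) hxy)
  rw [← hcard] at hn
  rw [← hW]
  refine (Agen_le_of_sub_mem (T := W.image φ) ?_ hn ?_).trans
    (Nat.pow_le_pow_left Finset.card_image_le 2)
  · refine ⟨?_, ?_⟩
    · simp only [Finset.mem_image]
      rintro _ ⟨x, hx, rfl⟩ _ ⟨y, hy, rfl⟩ _ ⟨z, hz, rfl⟩ hxy hxz hyz hcol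
      replace hxy : x ≠ y := fun h => hxy (h ▸ rfl)
      replace hxz : x ≠ z := fun h => hxz (h ▸ rfl)
      replace hyz : y ≠ z := fun h => hyz (h ▸ rfl)
      have h := hcol.plane_det_eq_zero
      simp only [hφs0, hφs1] at h
      exact hline _ (hmem y hy x hx) _ (hmem z hz x hx) (hne y x hxy.symm)
        (liftParaboloid_sub_ne_smul hxy hxz hyz) h
    · simp only [Finset.mem_image]
      rintro _ ⟨x, hx, rfl⟩ _ ⟨y, hy, rfl⟩ _ ⟨z, hz, rfl⟩ _ ⟨w, hw, rfl⟩ hxy hxz hxw hyz hyw hzw hco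
      replace hxy : x ≠ y := fun h => hxy (h ▸ rfl)
      replace hxz : x ≠ z := fun h => hxz (h ▸ rfl)
      replace hxw : x ≠ w := fun h => hxw (h ▸ rfl)
      replace hyz : y ≠ z := fun h => hyz (h ▸ rfl)
      replace hyw : y ≠ w := fun h => hyw (h ▸ rfl)
      replace hzw : z ≠ w := fun h => hzw (h ▸ rfl)
      have h := hco.circleDet_eq_zero
      simp only [hφs0, hφs1] at h
      refine hcirc _ (hmem y hy x hx) _ (hmem z hz x hx) _ (hmem w hw x hx) (hne y x hxy.symm)
        (liftParaboloid_sub_ne_smul hxy hxz hyz) (liftParaboloid_sub_ne_smul hxy hxw hyw)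
        (fun h' => hne z w hzw ?_) h
      rw [toReal_sub, toReal_sub] at h'
      rw [toReal_sub, sub_eq_zero]
      exact sub_left_injective h'
  · simp only [Finset.mem_image]
    rintro _ ⟨x, hx, rfl⟩ _ ⟨y, hy, rfl⟩
    exact ⟨_, hBW x hx y hy, hφsub _ _⟩

/-! ### Choice of the side and dimension -/

/-- Side `2 ^ d` balances the two losses: doubling every side of the box and adding the quadratic
coordinate each cost only `2 ^ O(d)`. -/
theorem Agen_le_two_pow {n d : ℕ} (hn : n ≤ 2 ^ (d * d)) :
    Agen n ≤ 2 ^ (2 * d ^ 2 + 10 * d + 4) := by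
  rw [pow_mul] at hn
  refine (Agen_le_of_le_pow hn).trans ?_
  have h1 : 2 * 2 ^ d + 1 ≤ 2 ^ (d + 2) := by
    have := Nat.one_le_two_pow (n := d)
    rw [pow_add]
    omega
  have h2 : 2 * (d * (2 ^ d) ^ 2) + 1 ≤ 2 ^ (3 * d + 2) := by
    have h3 : d * (2 ^ d) ^ 2 ≤ 2 ^ d * (2 ^ d) ^ 2 :=
      Nat.mul_le_mul_right _ Nat.lt_two_pow_self.le
    have h4 : 2 ^ (3 * d + 2) = 4 * (2 ^ d * (2 ^ d) ^ 2) := by ring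
    have := Nat.one_le_two_pow (n := d)
    have : 1 ≤ 2 ^ d * (2 ^ d) ^ 2 := Nat.one_le_iff_ne_zero.2 (by positivity)
    omega
  calc ((2 * 2 ^ d + 1) ^ d * (2 * (d * (2 ^ d) ^ 2) + 1)) ^ 2
      ≤ ((2 ^ (d + 2)) ^ d * 2 ^ (3 * d + 2)) ^ 2 :=
        Nat.pow_le_pow_left (Nat.mul_le_mul (Nat.pow_le_pow_left h1 d) h2) 2
    _ = 2 ^ (2 * d ^ 2 + 10 * d + 4) := by
        rw [← pow_mul, ← pow_add, ← pow_mul]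
        ring_nf

theorem mainTheorem3 :
    (fun n : ℕ => (Agen n : ℝ)) =O[atTop]
      (fun n : ℕ => (n : ℝ) ^ 2 * (2 : ℝ) ^ (22 * Real.sqrt (Real.logb 2 (n : ℝ)))) := by
  -- Since `d ≤ s + 1`, the exponent `2 * d ^ 2 + 10 * d + 4` is at most `2 * s ^ 2 + 14 * s + 16`;
  -- this gives the constant and leaves room below `22 * s`.
  refine IsBigO.of_bound (2 ^ (16 : ℕ)) ?_
  filter_upwards [eventually_ge_atTop 2] with n hn
  have hn0 : (0 : ℝ) < n := by positivity
  set s := Real.sqrt (Real.logb 2 (n : ℝ))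
  have hlog : 0 < Real.logb 2 (n : ℝ) := Real.logb_pos one_lt_two (by exact_mod_cast hn)
  have hs0 : 0 < s := Real.sqrt_pos.2 hlog
  have hs2 : s ^ 2 = Real.logb 2 (n : ℝ) := Real.sq_sqrt hlog.le
  have hns : (n : ℝ) = 2 ^ (s ^ 2) := by
    rw [hs2, Real.rpow_logb two_pos (by norm_num) hn0]
  set d := ⌈s⌉₊
  have hsd : s ≤ d := Nat.le_ceil s
  have hds : (d : ℝ) ≤ s + 1 := (Nat.ceil_lt_add_one hs0.le).le
  have hle : n ≤ 2 ^ (d * d) := by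
    have : (n : ℝ) ≤ 2 ^ ((d * d : ℕ) : ℝ) := by
      rw [hns]
      refine Real.rpow_le_rpow_of_exponent_le one_le_two ?_
      push_cast
      nlinarith
    rw [Real.rpow_natCast] at this
    exact_mod_cast this
  have hA : (Agen n : ℝ) ≤ 2 ^ ((2 * d ^ 2 + 10 * d + 4 : ℕ) : ℝ) := by
    rw [Real.rpow_natCast]
    exact_mod_cast Agen_le_two_pow hle
  rw [Real.norm_of_nonneg (Nat.cast_nonneg _), Real.norm_of_nonneg (by positivity)]
  refine hA.trans ?_
  rw [hns, ← Real.rpow_natCast, ← Real.rpow_natCast (2 ^ s ^ 2), ← Real.rpow_mul zero_le_two,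
    ← Real.rpow_add two_pos, ← Real.rpow_add two_pos]
  refine Real.rpow_le_rpow_of_exponent_le one_le_two ?_
  push_cast
  nlinarith
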